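/- Let $M_2$ denote the space of all complex $2\times 2$ matrices and $S_2$ its subspace of symmetric matrices ($A^{t}=A$), both equipped with the triple product $\{a,b,c\}=\frac12(ab^*c+cb^*a)$, where $b^*$ is the conjugate transpose of $b$. Let $C=S_2$ or $C=M_2$. For $a,b\in C$, we say that $a$ is a truncation of $b$ if $\{a,a,a\}=\{a,b,a\}$. A tripotent is an element $e\in C$ with $\{e,e,e\}=e$; it is minimal if $\{a\in C:\{e,e,a\}=a\}=\mathbb{C}e\neq\{0\}$. Let $\Delta:C\to C$ be a (not necessarily linear or continuous) bijection that preserves the truncation of triple products in both directions, that is, for all $a,b,c\in C$, $$a \text{ is a truncation of } \{b,c,b\}\iff \Delta(a)\text{ is a truncation of }\{\Delta(b),\Delta(c),\Delta(b)\}.$$ Then one of the following statements holds: (a) for each minimal tripotent $e$ in $C$ we have $\Delta(\lambda e)=\lambda\Delta(e)$ for every $\lambda\in\mathbb{C}$; (b) for each minimal tripotent $e$ in $C$ we have $\Delta(\lambda e)=\overline{\lambda}\,\Delta(e)$ for every $\lambda\in\mathbb{C}$. Consequently, $\Delta$ is a linear or a conjugate-linear triple automorphism of $C$, that is, a linear or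 conjugate-linear bijection with $\Delta(\{x,y,z\})=\{\Delta(x),\Delta(y),\Delta(z)\}$ for all $x,y,z\in C$. -/

import Mathlib

open scoped Matrix

/-- The algebraic part of the structure of a complex JB*-triple: a triple product that is linear
in the outer variables, conjugate-linear in the middle one, symmetric in the outer variables, and
satisfies the Jordan identity.  All notions below depend only on this part. -/
class JordanTriple (E : Type*) [AddCommGroup E] [Module ℂ E] where
  /-- the triple product `{x, y, z}` -/
  tp : E → E → E → E
  tp_comm : ∀ x y z, tp x y z = tp z y x
  tp_add_left : ∀ x x' y z, tp (x + x') y z = tp x y z + tp x' y z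
  tp_smul_left : ∀ (c : ℂ) x y z, tp (c • x) y z = c • tp x y z
  tp_add_mid : ∀ x y y' z, tp x (y + y') z = tp x y z + tp x y' z
  tp_smul_mid : ∀ (c : ℂ) x y z, tp x (c • y) z = (starRingEnd ℂ c) • tp x y z
  jordan : ∀ w v x y z,
    tp w v (tp x y z) = tp (tp w v x) y z - tp x (tp v w y) z + tp x y (tp w v z)

namespace JordanTriple

section general

variable {E : Type*} [AddCommGroup E] [Module ℂ E] [JordanTriple E]

/-- The quadratic operator `Q(b)(c) = {b, c, b}`. -/
def Q (b c : E) : E := tp b c b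

/-- `a` is a truncation of `b` if `{a, a, a} = {a, b, a}`. -/
def IsTruncation (a b : E) : Prop := tp a a a = tp a b a

/-- `Δ` preserves the truncation of triple products in both directions. -/
def PreservesTruncation (Δ : E → E) : Prop :=
  ∀ a b c : E, IsTruncation a (Q b c) ↔ IsTruncation (Δ a) (Q (Δ b) (Δ c))

/-- Tripotents: `{e, e, e} = e`. -/
def IsTripotent (e : E) : Prop := tp e e e = e

/-- The Peirce 2-subspace of `e`: the eigenspace of `L(e, e)` for the eigenvalue `1`. -/
def peirceTwo (e : E) : Set E := {a | tp e e a = a}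

/-- Minimal tripotents: tripotents `e` with `E₂(e) = ℂ e ≠ {0}`. -/
def IsMinimalTripotent (e : E) : Prop :=
  IsTripotent e ∧ peirceTwo e = Set.range (fun c : ℂ => c • e) ∧ peirceTwo e ≠ {0}

/-- `Δ` is a (complex-)linear triple automorphism. -/
def IsLinearTripleAut (Δ : E → E) : Prop :=
  ∃ T : E ≃ₗ[ℂ] E, (∀ x, T x = Δ x) ∧ ∀ x y z, T (tp x y z) = tp (T x) (T y) (T z)

/-- `Δ` is a conjugate-linear triple automorphism. -/
def IsConjLinearTripleAut (Δ : E → E) : Prop :=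
  ∃ T : E ≃ₛₗ[starRingEnd ℂ] E, (∀ x, T x = Δ x) ∧ ∀ x y z, T (tp x y z) = tp (T x) (T y) (T z)

end general

/-- `M₂`: all complex `2 × 2` matrices. -/
abbrev M₂ : Type := Matrix (Fin 2) (Fin 2) ℂ

/-- The triple product `{a, b, c} = (a b* c + c b* a) / 2` of matrices, `b*` the conjugate
transpose. -/
noncomputable def matTp (a b c : M₂) : M₂ := (1 / 2 : ℂ) • (a * bᴴ * c + c * bᴴ * a)

noncomputable instance instM₂ : JordanTriple M₂ where
  tp := matTp
  tp_comm x y z := by simp only [matTp]; rw [add_comm]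
  tp_add_left x x' y z := by
    simp only [matTp, add_mul, mul_add, ← smul_add]; congr 1; abel
  tp_smul_left c x y z := by
    simp only [matTp, smul_mul_assoc, mul_smul_comm, ← smul_add]; rw [smul_comm]
  tp_add_mid x y y' z := by
    simp only [matTp, Matrix.conjTranspose_add, add_mul, mul_add, ← smul_add]; congr 1; abel
  tp_smul_mid c x y z := by
    simp only [matTp, Matrix.conjTranspose_smul, smul_mul_assoc, mul_smul_comm, ← smul_add,
      starRingEnd_apply]
    rw [smul_comm]
  jordan w v x y z := by
    simp only [matTp, Matrix.conjTranspose_smul, Matrix.conjTranspose_add,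
      Matrix.conjTranspose_mul, Matrix.conjTranspose_conjTranspose, smul_mul_assoc,
      mul_smul_comm, add_mul, mul_add, smul_add, Matrix.mul_assoc]
    simp only [one_div, star_inv₀, star_ofNat]
    abel

/-- The symmetric complex `2 × 2` matrices (`Aᵀ = A`). -/
def symmetricMatrices : Submodule ℂ M₂ where
  carrier := {A | Aᵀ = A}
  add_mem' {A B} hA hB := by
    simp only [Set.mem_ofPred_eq, Matrix.transpose_add] at *; rw [hA, hB]
  zero_mem' := Matrix.transpose_zero
  smul_mem' c A hA := by
    simp only [Set.mem_ofPred_eq, Matrix.transpose_smul] at *; rw [hA]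

/-- `S₂`: the symmetric complex `2 × 2` matrices. -/
abbrev S₂ : Type := symmetricMatrices

theorem matTp_mem {a b c : M₂} (ha : a ∈ symmetricMatrices) (hb : b ∈ symmetricMatrices)
    (hc : c ∈ symmetricMatrices) : matTp a b c ∈ symmetricMatrices := by
  change aᵀ = a at ha
  change bᵀ = b at hb
  change cᵀ = c at hc
  have hb' : (bᴴ)ᵀ = bᴴ := by
    ext i j
    have := congrFun (congrFun hb i) j
    simp only [Matrix.transpose_apply, Matrix.conjTranspose_apply] at *
    rw [this]
  change (matTp a b c)ᵀ = matTp a b c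
  simp only [matTp, Matrix.transpose_smul, Matrix.transpose_add, Matrix.transpose_mul, ha, hb',
    hc, Matrix.mul_assoc]
  rw [add_comm]

/-- `S₂` with the triple product inherited from `M₂`. -/
noncomputable instance instS₂ : JordanTriple S₂ where
  tp a b c := ⟨matTp a b c, matTp_mem a.2 b.2 c.2⟩
  tp_comm x y z := Subtype.ext (instM₂.tp_comm (x : M₂) y z)
  tp_add_left x x' y z := Subtype.ext (instM₂.tp_add_left (x : M₂) x' y z)
  tp_smul_left c x y z := Subtype.ext (instM₂.tp_smul_left c (x : M₂) y z)
  tp_add_mid x y y' z := Subtype.ext (instM₂.tp_add_mid (x : M₂) y y' z)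
  tp_smul_mid c x y z := Subtype.ext (instM₂.tp_smul_mid c (x : M₂) y z)
  jordan w v x y z := Subtype.ext (instM₂.jordan (w : M₂) v x y z)

end JordanTriple

/-!
Both triples are treated at once as triples `E` with `S₂ ⊆ E ⊆ M₂` (`MatrixTriple`), with the
Hilbert–Schmidt inner product `form x y = tr (y* x)`. If `b` is singular, then
`Q b c = form b c • b` (`IsSingular.Q_eq`), so for singular `a`, `b` the truncation relation is an
equation between inner products.

The relation `Q b c = 0` is preserved, because it says that `0` is the only truncation of `Q b c`.
Hence `Δ` preserves singularity and, for singular `b`, the relation `form c b = 0`. Taking `a = b`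
in the hypothesis shows that `form c b = 1` is preserved as well. It follows that every minimal
tripotent `e` has a coefficient function `f = coeffMap Δ e` with `Δ (c • e) = f c • Δ e` and
`form (Δ x) (Δ e) = f (form x e)` for all `x` (`PreservesTruncation.form_map_map`). Two minimal
tripotents `e`, `v` with `p = form v e ≠ 0` are related by `coeffMap Δ v (p * d) = f p * f d`, so
that those which make the same nonzero inner product with a third one have the same coefficient
function. In this way the real rank-one projections `realAtom E θ` share one function `f`, which
commutes with conjugation and inversion and satisfies `f (t * c) = f t * f c` for `0 < t ≤ 1`.

The crucial value is `f (1 / 2) = 1 / 2`. In `S₂`, which has dimension three, it is forced by the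
Gram matrix of the images of the projections at the angles `0`, `π / 2`, `π / 4`, `-π / 4`
(`IsFramePair.eq_half`); in `M₂` it is Parseval's identity for the images of the matrix units
(`PreservesTruncation.coeffMap_half`). The identity
`realAtom 0 + realAtom (π / 2) = realAtom (π / 4) + realAtom (-π / 4)` then survives under `Δ`,
since the square of the norm of the difference is a combination of values of `f` at `0`, `1`, and
`1 / 2`; paired with `Δ c` it says that `f` is additive. So `f` is the identity or the conjugation
(`eq_id_or_eq_conj`). Since the images of the minimal tripotents with coefficient function `f`
separate points, `Δ` is linear or conjugate-linear and commutes with the quadratic operators, hence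
with the triple product by polarization (`SeparatesPoints.isTripleAut`).
-/

namespace JordanTriple

open ComplexConjugate

/-! ### Polarization and additive functions on the complex numbers -/

section

variable {E : Type*} [AddCommGroup E] [Module ℂ E] [JordanTriple E]

theorem tp_add_right (x y z z' : E) : tp x y (z + z') = tp x y z + tp x y z' := by
  rw [tp_comm, tp_add_left, tp_comm z, tp_comm z']

theorem two_smul_tp (x y z : E) : (2 : ℂ) • tp x y z = Q (x + z) y - Q x y - Q z y := by
  simp only [Q, tp_add_left, tp_add_right, tp_comm z y x, two_smul]
  abel

/-- The triple product is the polarization of the quadratic operators. -/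
theorem map_tp_of_map_Q {Δ : E → E} (hadd : ∀ x y, Δ (x + y) = Δ x + Δ y)
    (hQ : ∀ b c, Δ (Q b c) = Q (Δ b) (Δ c)) (x y z : E) :
    Δ (tp x y z) = tp (Δ x) (Δ y) (Δ z) := by
  let φ : E →+ E := AddMonoidHom.mk' Δ hadd
  have h := congrArg φ (two_smul_tp x y z)
  rw [two_smul, map_add, map_sub, map_sub] at h
  change Δ _ + Δ _ = Δ _ - Δ _ - Δ _ at h
  rw [hQ, hQ, hQ, hadd, ← two_smul_tp, ← two_smul ℂ] at h
  exact smul_right_injective E (two_ne_zero : (2 : ℂ) ≠ 0) h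

end

/-- An additive self-map of `ℂ` that commutes with conjugation and inversion and splits off
positive real factors is the identity or the conjugation. -/
theorem eq_id_or_eq_conj {f : ℂ → ℂ} (hadd : ∀ a b, f (a + b) = f a + f b) (hone : f 1 = 1)
    (hconj : ∀ a, f (conj a) = conj (f a)) (hinv : ∀ a, a ≠ 0 → f a * f a⁻¹ = 1)
    (hmul : ∀ t : ℝ, 0 < t → t ≤ 1 → ∀ a, f (t * a) = f t * f a) :
    (∀ a, f a = a) ∨ ∀ a, f a = conj a := by
  have hzero : f 0 = 0 := by simpa using hadd 0 0
  have hneg : ∀ a, f (-a) = -f a := fun a => by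
    have := hadd a (-a)
    rw [add_neg_cancel, hzero] at this
    linear_combination -this
  have hpos : ∀ t : ℝ, 0 < t → ∀ a, f (t * a) = f t * f a := by
    intro t ht a
    rcases le_total t 1 with h1 | h1
    · exact hmul t ht h1 a
    · have ht0 : (t : ℂ) ≠ 0 := by exact_mod_cast ht.ne'
      have h2 := hmul t⁻¹ (inv_pos.2 ht) (inv_le_one_of_one_le₀ h1) (t * a)
      rw [Complex.ofReal_inv, inv_mul_cancel_left₀ ht0] at h2
      rw [h2, ← mul_assoc, hinv _ ht0, one_mul]
  have hreal : ∀ (t : ℝ) (a : ℂ), f (t * a) = f t * f a := by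
    intro t a
    rcases lt_trichotomy t 0 with h | h | h
    · have := hpos (-t) (neg_pos.2 h) a
      rw [Complex.ofReal_neg, neg_mul, hneg, hneg] at this
      linear_combination -this
    · simp [h, hzero]
    · exact hpos t h a
  have him : ∀ t : ℝ, ((f t).re : ℂ) = f t := fun t =>
    Complex.conj_eq_iff_re.1 (by rw [← hconj, Complex.conj_ofReal])
  -- `f` restricts to a ring endomorphism of `ℝ`, and the identity is the only one.
  let φ : ℝ →+* ℝ :=
    { toFun := fun t => (f t).re
      map_one' := by simp [hone]
      map_zero' := by simp [hzero]
      map_add' := fun s t => by simp [hadd]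
      map_mul' := fun s t => by
        rw [Complex.ofReal_mul, hreal, ← him s, ← him t, ← Complex.ofReal_mul]
        simp }
  have hid : ∀ t : ℝ, f t = t := fun t => by
    rw [← him t]
    exact congrArg _ (RingHom.congr_fun (Subsingleton.elim φ (RingHom.id ℝ)) t)
  have hI : f Complex.I * f Complex.I = -1 := by
    have := hinv Complex.I Complex.I_ne_zero
    rw [Complex.inv_I, hneg] at this
    linear_combination -this
  have hall : ∀ a, f a = a.re + a.im * f Complex.I := fun a => by
    conv_lhs => rw [← Complex.re_add_im a]
    rw [hadd, hreal, hid, hid]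
  have hcases : (f Complex.I - Complex.I) * (f Complex.I + Complex.I) = 0 := by
    linear_combination hI - Complex.I_mul_I
  rcases mul_eq_zero.1 hcases with h | h
  · left
    intro a
    rw [hall, sub_eq_zero.1 h, Complex.re_add_im]
  · right
    intro a
    rw [hall, eq_neg_of_add_eq_zero_left h]
    apply Complex.ext <;> simp

/-! ### Triples of matrices and their inner product -/

/-- A realization of a triple as a subtriple of `M₂` that contains the symmetric matrices. -/
class MatrixTriple (E : Type*) [AddCommGroup E] [Module ℂ E] [JordanTriple E] where
  /-- the inclusion into the matrices -/
  toMat : E →ₗ[ℂ] M₂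
  toMat_injective : Function.Injective toMat
  toMat_tp : ∀ x y z : E, toMat (tp x y z) = matTp (toMat x) (toMat y) (toMat z)
  exists_toMat_eq : ∀ A : M₂, Aᵀ = A → ∃ x, toMat x = A

noncomputable instance : MatrixTriple M₂ where
  toMat := LinearMap.id
  toMat_injective := Function.injective_id
  toMat_tp _ _ _ := rfl
  exists_toMat_eq A _ := ⟨A, rfl⟩

noncomputable instance : MatrixTriple S₂ where
  toMat := symmetricMatrices.subtype
  toMat_injective := Subtype.val_injective
  toMat_tp _ _ _ := rfl
  exists_toMat_eq A hA := ⟨⟨A, hA⟩, rfl⟩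

open MatrixTriple

variable {E : Type*} [AddCommGroup E] [Module ℂ E] [JordanTriple E] [MatrixTriple E]

/-- The Hilbert–Schmidt inner product `tr (y* x)`, linear in the first variable. -/
noncomputable def form (x y : E) : ℂ := ((toMat y)ᴴ * toMat x).trace

theorem form_eq (x y : E) : form x y =
    toMat x 0 0 * conj (toMat y 0 0) + toMat x 0 1 * conj (toMat y 0 1)
      + toMat x 1 0 * conj (toMat y 1 0) + toMat x 1 1 * conj (toMat y 1 1) := by
  simp only [form, Matrix.trace_fin_two, Matrix.mul_apply, Fin.sum_univ_two,
    Matrix.conjTranspose_apply, RCLike.star_def]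
  ring

theorem form_add_left (x x' y : E) : form (x + x') y = form x y + form x' y := by
  simp only [form_eq, map_add, Matrix.add_apply]; ring

theorem form_sub_left (x x' y : E) : form (x - x') y = form x y - form x' y := by
  simp only [form_eq, map_sub, Matrix.sub_apply]; ring

theorem form_smul_left (c : ℂ) (x y : E) : form (c • x) y = c * form x y := by
  simp only [form_eq, map_smul, Matrix.smul_apply, smul_eq_mul]; ring

theorem conj_form (x y : E) : conj (form x y) = form y x := by
  simp only [form_eq, map_add, map_mul, Complex.conj_conj]; ring

theorem form_add_right (x y y' : E) : form x (y + y') = form x y + form x y' := by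
  simp only [form_eq, map_add, Matrix.add_apply]; ring

theorem form_sub_right (x y y' : E) : form x (y - y') = form x y - form x y' := by
  simp only [form_eq, map_sub, Matrix.sub_apply]; ring

theorem form_smul_right (c : ℂ) (x y : E) : form x (c • y) = conj c * form x y := by
  simp only [form_eq, map_smul, Matrix.smul_apply, smul_eq_mul, map_mul]; ring

@[simp] theorem form_zero_left (y : E) : form 0 y = 0 := by simp [form_eq]

@[simp] theorem form_zero_right (x : E) : form x 0 = 0 := by simp [form_eq]

open scoped ComplexOrder in
theorem form_self_eq_zero {x : E} : form x x = 0 ↔ x = 0 := by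
  rw [form, Matrix.trace_conjTranspose_mul_self_eq_zero_iff,
    map_eq_zero_iff _ toMat_injective]

/-- An orthogonal family of the size of the dimension separates points. -/
theorem eq_zero_of_form_eq_zero {n : ℕ} (hn : Module.finrank ℂ E ≤ n) (hE : Module.Finite ℂ E)
    (v : Fin n → E) (hv : ∀ i, v i ≠ 0) (hvv : ∀ i j, i ≠ j → form (v i) (v j) = 0)
    (x : E) (hx : ∀ i, form x (v i) = 0) : x = 0 := by
  by_contra h0
  have hne : ∀ i, (Fin.cons x v : Fin (n + 1) → E) i ≠ 0 := Fin.cases h0 hv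
  have hort : ∀ i j, i ≠ j → form ((Fin.cons x v : Fin (n + 1) → E) i)
      ((Fin.cons x v : Fin (n + 1) → E) j) = 0 := by
    intro i j
    refine Fin.cases ?_ (fun i => ?_) i <;> refine Fin.cases ?_ (fun j => ?_) j
    · simp
    · intro _
      simpa using hx j
    · intro _
      rw [← conj_form]
      simpa using hx i
    · intro h
      simpa using hvv i j (by simpa using h)
  have hli : LinearIndependent ℂ (Fin.cons x v : Fin (n + 1) → E) := by
    rw [Fintype.linearIndependent_iff]
    intro g hg i
    have hsum : form (∑ j, g j • (Fin.cons x v : Fin (n + 1) → E) j)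
        ((Fin.cons x v : Fin (n + 1) → E) i)
        = ∑ j, g j * form ((Fin.cons x v : Fin (n + 1) → E) j)
          ((Fin.cons x v : Fin (n + 1) → E) i) := by
      let φ : E →ₗ[ℂ] ℂ :=
        { toFun := fun y => form y ((Fin.cons x v : Fin (n + 1) → E) i)
          map_add' := fun y z => form_add_left _ _ _
          map_smul' := fun c y => form_smul_left _ _ _ }
      change φ _ = _
      rw [map_sum]
      exact Finset.sum_congr rfl fun j _ => form_smul_left _ _ _
    rw [hg, form_zero_left, Finset.sum_eq_single i
      (fun j _ hj => by rw [hort j i hj, mul_zero]) (by simp)] at hsum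
    exact (mul_eq_zero.1 hsum.symm).resolve_right fun h => hne i (form_self_eq_zero.1 h)
  have := hli.fintype_card_le_finrank
  simp at this
  omega

/-! ### Elements of rank one -/

/-- `b` is singular, that is, a scalar multiple of a minimal tripotent. -/
def IsSingular (b : E) : Prop := (toMat b).det = 0

theorem toMat_Q (b c : E) : toMat (Q b c) = toMat b * (toMat c)ᴴ * toMat b := by
  rw [Q, toMat_tp, matTp, ← two_smul ℂ, smul_smul]; norm_num

/-- The quadratic operator of an element of rank at most one has rank at most one. This is the
Cayley–Hamilton identity `b y b = tr (y b) b - det b adj y`. -/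
theorem IsSingular.Q_eq {b : E} (hb : IsSingular b) (c : E) : Q b c = form b c • b := by
  apply toMat_injective
  rw [toMat_Q, map_smul, form]
  rw [IsSingular, Matrix.det_fin_two] at hb
  generalize (toMat c)ᴴ = y
  generalize toMat b = m at *
  ext i j
  fin_cases i <;> fin_cases j <;>
    simp [Matrix.mul_apply, Matrix.trace_fin_two, Fin.sum_univ_two] <;> grind

theorem isSingular_of_Q_eq_zero {b c : E} (hc : c ≠ 0) (h : Q b c = 0) : IsSingular b := by
  by_contra hb
  have hu : IsUnit (toMat b) := (Matrix.isUnit_iff_isUnit_det _).2 (isUnit_iff_ne_zero.2 hb)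
  have h' := toMat_Q b c
  rw [h, map_zero] at h'
  have h2 := hu.mul_left_eq_zero.1 h'.symm
  have h3 := hu.mul_right_eq_zero.1 h2
  rw [Matrix.conjTranspose_eq_zero, map_eq_zero_iff _ toMat_injective] at h3
  exact hc h3

theorem IsSingular.smul {b : E} (hb : IsSingular b) (c : ℂ) : IsSingular (c • b) := by
  rw [IsSingular, map_smul, Matrix.det_smul, hb, mul_zero]

theorem Q_zero_left (c : E) : Q 0 c = 0 := by
  apply toMat_injective; rw [toMat_Q]; simp

theorem Q_self_eq_zero {a : E} : Q a a = 0 ↔ a = 0 := by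
  refine ⟨fun h => ?_, fun h => by rw [h, Q_zero_left]⟩
  by_contra h0
  have := (isSingular_of_Q_eq_zero h0 h).Q_eq a
  rw [h, eq_comm, smul_eq_zero, form_self_eq_zero] at this
  simp_all

/-- For singular `a` both sides of `{a, a, a} = {a, x, a}` are multiples of `a`. -/
theorem IsSingular.isTruncation_iff {a : E} (ha : IsSingular a) (x : E) :
    IsTruncation a x ↔ form a a = form a x := by
  change Q a a = Q a x ↔ _
  rw [ha.Q_eq, ha.Q_eq]
  by_cases h0 : a = 0
  · simp [h0]
  · exact (smul_left_injective ℂ h0).eq_iff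

/-! ### Minimal tripotents -/

/-- The symmetric element `ξ ξᵀ` for the real unit vector `ξ` at angle `θ`. -/
noncomputable def realAtom (E : Type*) [AddCommGroup E] [Module ℂ E] [JordanTriple E]
    [MatrixTriple E] (θ : ℝ) : E :=
  (exists_toMat_eq (E := E)
    !![(Real.cos θ : ℂ) ^ 2, Real.cos θ * Real.sin θ; Real.cos θ * Real.sin θ, Real.sin θ ^ 2]
    (by ext i j; fin_cases i <;> fin_cases j <;> rfl)).choose

theorem toMat_realAtom (θ : ℝ) : toMat (realAtom E θ) =
    !![(Real.cos θ : ℂ) ^ 2, Real.cos θ * Real.sin θ;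
      Real.cos θ * Real.sin θ, Real.sin θ ^ 2] :=
  (exists_toMat_eq (E := E) _ (by ext i j; fin_cases i <;> fin_cases j <;> rfl)).choose_spec

theorem form_realAtom (x : E) (θ : ℝ) : form x (realAtom E θ) =
    toMat x 0 0 * Real.cos θ ^ 2 + (toMat x 0 1 + toMat x 1 0) * (Real.cos θ * Real.sin θ)
      + toMat x 1 1 * Real.sin θ ^ 2 := by
  rw [form_eq, toMat_realAtom]
  simp only [Matrix.of_apply, Matrix.cons_val', Matrix.cons_val_zero, Matrix.cons_val_one,
    Matrix.cons_val_fin_one, map_mul, map_pow, Complex.conj_ofReal]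
  ring

theorem form_realAtom_realAtom (θ φ : ℝ) :
    form (realAtom E θ) (realAtom E φ) = ((Real.cos (θ - φ) ^ 2 : ℝ) : ℂ) := by
  rw [form_realAtom, toMat_realAtom, Real.cos_sub]
  simp only [Matrix.of_apply, Matrix.cons_val', Matrix.cons_val_zero, Matrix.cons_val_one,
    Matrix.cons_val_fin_one]
  push_cast
  ring

/-- The minimal tripotents, described through the matrix realization: the elements of rank one
and Hilbert–Schmidt norm one. -/
structure IsAtom (e : E) : Prop where
  isSingular : IsSingular e
  form_self : form e e = 1

theorem IsAtom.ne_zero {e : E} (he : IsAtom e) : e ≠ 0 := by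
  rintro rfl; simpa using he.form_self

theorem isAtom_realAtom (θ : ℝ) : IsAtom (realAtom E θ) where
  isSingular := by rw [IsSingular, toMat_realAtom, Matrix.det_fin_two_of]; ring
  form_self := by rw [form_realAtom_realAtom]; simp

theorem exists_ne_zero_form_eq_zero (e : E) : ∃ c, c ≠ 0 ∧ form c e = 0 := by
  by_cases h : form (realAtom E 0) e = 0
  · exact ⟨_, (isAtom_realAtom 0).ne_zero, h⟩
  · refine ⟨form (realAtom E 0) e • realAtom E (Real.pi / 2)
      - form (realAtom E (Real.pi / 2)) e • realAtom E 0, fun h0 => h ?_, ?_⟩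
    · have := congrArg (fun x => form x (realAtom E (Real.pi / 2))) h0
      simpa [form_sub_left, form_smul_left, form_realAtom_realAtom] using this
    · rw [form_sub_left, form_smul_left, form_smul_left]; ring

/-! ### What a truncation preserver keeps -/

section preservers

variable {Δ : E → E}

/-- `0` is a truncation of every element, and it is the only truncation of `0`. -/
theorem PreservesTruncation.map_zero (hΔ : PreservesTruncation Δ) (hb : Function.Bijective Δ) :
    Δ 0 = 0 := by
  obtain ⟨z, hz⟩ := hb.2 0
  have h : IsTruncation (0 : E) (Q z 0) := by
    change Q 0 0 = Q 0 _; rw [Q_zero_left, Q_zero_left]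
  have h' := (hΔ 0 z 0).1 h
  rw [hz, Q_zero_left] at h'
  have h2 : Q (Δ 0) (Δ 0) = Q (Δ 0) 0 := h'
  rw [← Q_self_eq_zero, h2]
  apply toMat_injective
  simp [toMat_Q]

theorem PreservesTruncation.map_eq_zero_iff (hΔ : PreservesTruncation Δ)
    (hb : Function.Bijective Δ) {x : E} : Δ x = 0 ↔ x = 0 :=
  ⟨fun h => hb.1 (h.trans (hΔ.map_zero hb).symm), fun h => h ▸ hΔ.map_zero hb⟩

theorem isTruncation_zero_right {a : E} : IsTruncation a 0 ↔ a = 0 := by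
  change Q a a = Q a 0 ↔ _
  rw [show Q a 0 = 0 from toMat_injective (by simp [toMat_Q]), Q_self_eq_zero]

/-- `Q b c` vanishes exactly when `0` is its only truncation. -/
theorem PreservesTruncation.Q_eq_zero_iff (hΔ : PreservesTruncation Δ)
    (hb : Function.Bijective Δ) {b c : E} : Q (Δ b) (Δ c) = 0 ↔ Q b c = 0 := by
  constructor
  · intro h
    have := (hΔ (Q b c) b c).1 rfl
    rwa [h, isTruncation_zero_right, hΔ.map_eq_zero_iff hb] at this
  · intro h
    obtain ⟨a, ha⟩ := hb.2 (Q (Δ b) (Δ c))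
    have := (hΔ a b c).2 (by rw [ha]; rfl)
    rw [h, isTruncation_zero_right] at this
    rw [← ha, this, hΔ.map_zero hb]

/-- A nonzero `b` is singular exactly when `Q b` is not injective, and this is preserved. -/
theorem PreservesTruncation.isSingular (hΔ : PreservesTruncation Δ)
    (hb : Function.Bijective Δ) {b : E} (h : IsSingular b) : IsSingular (Δ b) := by
  obtain ⟨c, hc, hcb⟩ := exists_ne_zero_form_eq_zero b
  refine isSingular_of_Q_eq_zero (c := Δ c) (mt (hΔ.map_eq_zero_iff hb).1 hc) ?_
  rw [hΔ.Q_eq_zero_iff hb, h.Q_eq, ← conj_form, hcb, _root_.map_zero, zero_smul]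

theorem IsSingular.Q_eq_zero_iff {b : E} (h : IsSingular b) (c : E) :
    Q b c = 0 ↔ form c b = 0 := by
  rw [h.Q_eq, smul_eq_zero, ← conj_form b c, _root_.map_eq_zero]
  exact ⟨fun h => h.elim id fun h0 => by rw [h0, form_zero_left], Or.inl⟩

theorem PreservesTruncation.form_eq_zero_iff (hΔ : PreservesTruncation Δ)
    (hb : Function.Bijective Δ) {b : E} (h : IsSingular b) (c : E) :
    form (Δ c) (Δ b) = 0 ↔ form c b = 0 := by
  rw [← h.Q_eq_zero_iff, ← (hΔ.isSingular hb h).Q_eq_zero_iff, hΔ.Q_eq_zero_iff hb]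

theorem IsSingular.isTruncation_Q_self_iff {a : E} (h : IsSingular a) (h0 : a ≠ 0) (c : E) :
    IsTruncation a (Q a c) ↔ form c a = 1 := by
  rw [h.isTruncation_iff, h.Q_eq, form_smul_right, conj_form, eq_comm,
    mul_eq_right₀ (mt form_self_eq_zero.1 h0)]

theorem PreservesTruncation.form_eq_one_iff (hΔ : PreservesTruncation Δ)
    (hb : Function.Bijective Δ) {a : E} (h : IsSingular a) (h0 : a ≠ 0) (c : E) :
    form (Δ c) (Δ a) = 1 ↔ form c a = 1 := by
  rw [← h.isTruncation_Q_self_iff h0, hΔ a a c,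
    (hΔ.isSingular hb h).isTruncation_Q_self_iff (mt (hΔ.map_eq_zero_iff hb).1 h0)]

theorem PreservesTruncation.isAtom (hΔ : PreservesTruncation Δ)
    (hb : Function.Bijective Δ) {e : E} (he : IsAtom e) : IsAtom (Δ e) where
  isSingular := hΔ.isSingular hb he.isSingular
  form_self := (hΔ.form_eq_one_iff hb he.isSingular he.ne_zero e).2 he.form_self

/-! ### Coefficient functions -/

/-- The function `f` with `Δ (c • e) = f c • Δ e`, for a minimal tripotent `e`. -/
noncomputable def coeffMap (Δ : E → E) (e : E) (c : ℂ) : ℂ := form (Δ (c • e)) (Δ e)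

/-- The orthogonal complement of `c • e` contains that of `e`, so that of `Δ (c • e)` contains that
of `Δ e`; the component of `Δ (c • e)` orthogonal to `Δ e` is then orthogonal to itself. -/
theorem PreservesTruncation.map_smul (hΔ : PreservesTruncation Δ)
    (hb : Function.Bijective Δ) {e : E} (he : IsAtom e) (c : ℂ) :
    Δ (c • e) = coeffMap Δ e c • Δ e := by
  by_cases hc : c = 0
  · simp [hc, coeffMap, hΔ.map_zero hb]
  rw [← sub_eq_zero, ← form_self_eq_zero]
  have h1 : form (Δ (c • e) - coeffMap Δ e c • Δ e) (Δ e) = 0 := by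
    rw [form_sub_left, form_smul_left, (hΔ.isAtom hb he).form_self, coeffMap]; ring
  have h2 : form (Δ (c • e) - coeffMap Δ e c • Δ e) (Δ (c • e)) = 0 := by
    obtain ⟨x, hx⟩ := hb.2 (Δ (c • e) - coeffMap Δ e c • Δ e)
    rw [← hx] at h1 ⊢
    rw [hΔ.form_eq_zero_iff hb he.isSingular] at h1
    rw [hΔ.form_eq_zero_iff hb (he.isSingular.smul c), form_smul_right, h1, mul_zero]
  rw [form_sub_right, form_smul_right, h1, h2]; ring

@[simp] theorem PreservesTruncation.coeffMap_zero (hΔ : PreservesTruncation Δ)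
    (hb : Function.Bijective Δ) (e : E) : coeffMap Δ e 0 = 0 := by
  simp [coeffMap, hΔ.map_zero hb]

theorem PreservesTruncation.coeffMap_one (hΔ : PreservesTruncation Δ)
    (hb : Function.Bijective Δ) {e : E} (he : IsAtom e) : coeffMap Δ e 1 = 1 := by
  rw [coeffMap, one_smul, (hΔ.isAtom hb he).form_self]

theorem PreservesTruncation.coeffMap_ne_zero (hΔ : PreservesTruncation Δ)
    (hb : Function.Bijective Δ) {e : E} (he : IsAtom e) {c : ℂ} (hc : c ≠ 0) :
    coeffMap Δ e c ≠ 0 := by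
  rw [coeffMap, Ne, hΔ.form_eq_zero_iff hb he.isSingular, form_smul_left, he.form_self, mul_one]
  exact hc

/-- The equation `form c e = μ` is `form c a = 1` for the multiple `a = (conj μ)⁻¹ • e` of `e`,
and it is satisfied by `c = μ • e`. -/
theorem PreservesTruncation.form_map_map (hΔ : PreservesTruncation Δ)
    (hb : Function.Bijective Δ) {e : E} (he : IsAtom e) (c : E) :
    form (Δ c) (Δ e) = coeffMap Δ e (form c e) := by
  by_cases h0 : form c e = 0
  · rw [h0, hΔ.coeffMap_zero hb, hΔ.form_eq_zero_iff hb he.isSingular, h0]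
  have hr0 : (conj (form c e))⁻¹ ≠ 0 := inv_ne_zero ((_root_.map_ne_zero _).2 h0)
  have key : ∀ d : E, form d e = form c e →
      form (Δ d) (Δ e) * conj (coeffMap Δ e (conj (form c e))⁻¹) = 1 := by
    intro d hd
    have := (hΔ.form_eq_one_iff hb (he.isSingular.smul _)
      (smul_ne_zero hr0 he.ne_zero) d).2 (by
        rw [form_smul_right, hd, map_inv₀, Complex.conj_conj, inv_mul_cancel₀ h0])
    rw [hΔ.map_smul hb he, form_smul_right] at this
    rw [mul_comm, this]
  have h1 := key c rfl
  have h2 := key (form c e • e) (by rw [form_smul_left, he.form_self, mul_one])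
  exact mul_right_cancel₀ (right_ne_zero_of_mul_eq_one h1) (h1.trans h2.symm)

theorem PreservesTruncation.coeffMap_mul_conj_inv (hΔ : PreservesTruncation Δ)
    (hb : Function.Bijective Δ) {e : E} (he : IsAtom e) {c : ℂ} (hc : c ≠ 0) :
    coeffMap Δ e c * conj (coeffMap Δ e (conj c)⁻¹) = 1 := by
  have hr0 : (conj c)⁻¹ ≠ 0 := inv_ne_zero ((_root_.map_ne_zero _).2 hc)
  have := (hΔ.form_eq_one_iff hb (he.isSingular.smul _)
      (smul_ne_zero hr0 he.ne_zero) (c • e)).2 (by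
        rw [form_smul_right, form_smul_left, he.form_self, map_inv₀, Complex.conj_conj, mul_one,
          inv_mul_cancel₀ hc])
  rw [hΔ.map_smul hb he, hΔ.map_smul hb he, form_smul_right, form_smul_left,
    (hΔ.isAtom hb he).form_self] at this
  rw [← this]; ring

theorem IsAtom.isTruncation_smul_iff {v : E} (hv : IsAtom v) {c : ℂ} (hc : c ≠ 0) (x : E) :
    IsTruncation (c • v) x ↔ form x v = c := by
  rw [(hv.isSingular.smul c).isTruncation_iff, form_smul_left, form_smul_left, form_smul_right,
    hv.form_self, mul_one, mul_right_inj' hc, ← conj_form x v, (starRingEnd ℂ).injective.eq_iff,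
    eq_comm]

/-- Two minimal tripotents interact: the relation that `c • v` is a truncation of
`Q e (d • e) = conj d • e` is `c = conj d * form e v`. -/
theorem PreservesTruncation.conj_coeffMap_mul (hΔ : PreservesTruncation Δ)
    (hb : Function.Bijective Δ) {e v : E} (he : IsAtom e) (hv : IsAtom v)
    (h : form v e ≠ 0) (d : ℂ) :
    conj (coeffMap Δ v (conj (form v e * d))) = coeffMap Δ e (form v e) * coeffMap Δ e d := by
  by_cases hd : d = 0
  · simp [hd, hΔ.coeffMap_zero hb]
  have hc : conj (form v e * d) ≠ 0 := (_root_.map_ne_zero _).2 (mul_ne_zero h hd)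
  have h1 : IsTruncation (conj (form v e * d) • v) (Q e (d • e)) := by
    rw [hv.isTruncation_smul_iff hc, he.isSingular.Q_eq, form_smul_left, form_smul_right,
      he.form_self, map_mul, conj_form]
    ring
  rw [hΔ, hΔ.map_smul hb hv, hΔ.map_smul hb he,
    (hΔ.isAtom hb hv).isTruncation_smul_iff (hΔ.coeffMap_ne_zero hb hv hc),
    (hΔ.isAtom hb he).isSingular.Q_eq, form_smul_left, form_smul_right,
    (hΔ.isAtom hb he).form_self, mul_one] at h1
  rw [← h1, map_mul, Complex.conj_conj, conj_form, hΔ.form_map_map hb he]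
  ring

theorem PreservesTruncation.coeffMap_conj (hΔ : PreservesTruncation Δ)
    (hb : Function.Bijective Δ) {e : E} (he : IsAtom e) (c : ℂ) :
    coeffMap Δ e (conj c) = conj (coeffMap Δ e c) := by
  have := hΔ.conj_coeffMap_mul hb he he (by rw [he.form_self]; exact one_ne_zero) c
  rw [he.form_self, one_mul, hΔ.coeffMap_one hb he, one_mul] at this
  rw [← this, Complex.conj_conj]

theorem PreservesTruncation.coeffMap_mul (hΔ : PreservesTruncation Δ)
    (hb : Function.Bijective Δ) {e v : E} (he : IsAtom e) (hv : IsAtom v)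
    (h : form v e ≠ 0) (d : ℂ) :
    coeffMap Δ v (form v e * d) = coeffMap Δ e (form v e) * coeffMap Δ e d := by
  rw [← hΔ.conj_coeffMap_mul hb he hv h, hΔ.coeffMap_conj hb hv, Complex.conj_conj]

theorem PreservesTruncation.coeffMap_inv (hΔ : PreservesTruncation Δ)
    (hb : Function.Bijective Δ) {e : E} (he : IsAtom e) {c : ℂ} (hc : c ≠ 0) :
    coeffMap Δ e c * coeffMap Δ e c⁻¹ = 1 := by
  rw [← hΔ.coeffMap_mul_conj_inv hb he hc, ← hΔ.coeffMap_conj hb he, map_inv₀,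
    Complex.conj_conj]

/-- Minimal tripotents that make the same nonzero inner product with a third one have the same
coefficient function. -/
theorem PreservesTruncation.coeffMap_eq (hΔ : PreservesTruncation Δ)
    (hb : Function.Bijective Δ) {e v w : E} (he : IsAtom e) (hv : IsAtom v) (hw : IsAtom w)
    (h : form e w = form v w) (h0 : form v w ≠ 0) : coeffMap Δ e = coeffMap Δ v := by
  funext c
  have h1 := hΔ.coeffMap_mul hb hw he (h ▸ h0) ((form v w)⁻¹ * c)
  have h2 := hΔ.coeffMap_mul hb hw hv h0 ((form v w)⁻¹ * c)
  rw [h, ← h2, mul_inv_cancel_left₀ h0] at h1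
  exact h1

theorem PreservesTruncation.coeffMap_realAtom (hΔ : PreservesTruncation Δ)
    (hb : Function.Bijective Δ) {θ : ℝ} (h : |θ| < Real.pi) :
    coeffMap Δ (realAtom E θ) = coeffMap Δ (realAtom E 0) := by
  -- The angle `θ / 2` is equally far from `0` and from `θ`.
  refine hΔ.coeffMap_eq hb (isAtom_realAtom θ) (isAtom_realAtom 0)
    (isAtom_realAtom (θ / 2)) ?_ ?_
  · rw [form_realAtom_realAtom, form_realAtom_realAtom, zero_sub, Real.cos_neg, sub_half]
  · rw [form_realAtom_realAtom, zero_sub, Real.cos_neg, Complex.ofReal_ne_zero]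
    rw [abs_lt] at h
    exact pow_ne_zero 2 (Real.cos_pos_of_mem_Ioo ⟨by linarith, by linarith⟩).ne'

/-- Every `t ∈ (0, 1]` is the inner product `cos² θ` of the projections at the angles `θ` and `0`,
which have the same coefficient function. -/
theorem PreservesTruncation.coeffMap_ofReal_mul (hΔ : PreservesTruncation Δ)
    (hb : Function.Bijective Δ) {t : ℝ} (h0 : 0 < t) (h1 : t ≤ 1) (c : ℂ) :
    coeffMap Δ (realAtom E 0) (t * c)
      = coeffMap Δ (realAtom E 0) t * coeffMap Δ (realAtom E 0) c := by
  have hcos : Real.cos (Real.arccos √t) ^ 2 = t := by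
    rw [Real.cos_arccos (by linarith [Real.sqrt_nonneg t]) (Real.sqrt_le_one.2 h1),
      Real.sq_sqrt h0.le]
  have hform : form (realAtom E (Real.arccos √t)) (realAtom E 0) = (t : ℂ) := by
    rw [form_realAtom_realAtom, sub_zero, hcos]
  have := hΔ.coeffMap_mul hb (isAtom_realAtom 0) (isAtom_realAtom (E := E) (Real.arccos √t))
    (by rw [hform]; exact_mod_cast h0.ne') c
  rwa [hform, hΔ.coeffMap_realAtom hb] at this
  rw [abs_of_nonneg (Real.arccos_nonneg _)]
  linarith [Real.arccos_le_pi_div_two.2 (Real.sqrt_nonneg t), Real.pi_pos]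

/-- The value at `1 / 2` is the square of the value at `√(1 / 2)`, which is real. -/
theorem PreservesTruncation.coeffMap_half_pos (hΔ : PreservesTruncation Δ)
    (hb : Function.Bijective Δ) :
    ∃ r : ℝ, 0 < r ∧ coeffMap Δ (realAtom E 0) (1 / 2) = r := by
  obtain ⟨s, hs⟩ := Complex.conj_eq_iff_real.1
    ((hΔ.coeffMap_conj hb (isAtom_realAtom (E := E) 0) ((√(1 / 2) : ℝ) : ℂ)).symm.trans
      (by rw [Complex.conj_ofReal]))
  have h1 := hΔ.coeffMap_ofReal_mul hb (t := √(1 / 2)) (by positivity)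
    (Real.sqrt_le_one.2 (by norm_num)) ((√(1 / 2) : ℝ) : ℂ)
  have h2 : ((√(1 / 2) : ℝ) : ℂ) * ((√(1 / 2) : ℝ) : ℂ) = 1 / 2 := by
    rw [← Complex.ofReal_mul, Real.mul_self_sqrt (by norm_num)]; norm_num
  have h3 : s ≠ 0 := by
    rintro rfl
    refine hΔ.coeffMap_ne_zero hb (isAtom_realAtom (E := E) 0) ?_ (hs.trans Complex.ofReal_zero)
    exact Complex.ofReal_ne_zero.2 (by positivity)
  refine ⟨s * s, mul_self_pos.2 h3, ?_⟩
  rw [← h2, h1, hs, Complex.ofReal_mul]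

/-! ### Additivity of the coefficient function -/

theorem PreservesTruncation.form_map_realAtom (hΔ : PreservesTruncation Δ)
    (hb : Function.Bijective Δ) {φ : ℝ} (h : |φ| < Real.pi) (x : E) :
    form (Δ x) (Δ (realAtom E φ)) = coeffMap Δ (realAtom E 0) (form x (realAtom E φ)) := by
  rw [hΔ.form_map_map hb (isAtom_realAtom φ), hΔ.coeffMap_realAtom hb h]

theorem cos_pi_div_four_sq : Real.cos (Real.pi / 4) ^ 2 = 1 / 2 := by
  rw [Real.cos_pi_div_four, div_pow, Real.sq_sqrt (by norm_num)]; norm_num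

theorem abs_zero_lt_pi : |(0 : ℝ)| < Real.pi := by simpa using Real.pi_pos

theorem abs_pi_div_two_lt_pi : |Real.pi / 2| < Real.pi := by
  rw [abs_of_pos Real.pi_div_two_pos]; linarith [Real.pi_pos]

theorem abs_pi_div_four_lt_pi : |Real.pi / 4| < Real.pi := by
  rw [abs_of_pos (by positivity)]; linarith [Real.pi_pos]

theorem abs_neg_pi_div_four_lt_pi : |-(Real.pi / 4)| < Real.pi := by
  rw [abs_neg]; exact abs_pi_div_four_lt_pi

/-- Two orthonormal pairs `v₁, v₂` and `w₁, w₂` whose mixed inner products are all equal to the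
real number `r`. -/
structure IsFramePair (r : ℝ) (v₁ v₂ w₁ w₂ : E) : Prop where
  v₁₁ : form v₁ v₁ = 1
  v₂₂ : form v₂ v₂ = 1
  v₁₂ : form v₁ v₂ = 0
  w₁₁ : form w₁ w₁ = 1
  w₂₂ : form w₂ w₂ = 1
  w₁₂ : form w₁ w₂ = 0
  v₁w₁ : form v₁ w₁ = r
  v₁w₂ : form v₁ w₂ = r
  v₂w₁ : form v₂ w₁ = r
  v₂w₂ : form v₂ w₂ = r

theorem form_swap {x y : E} {r : ℝ} (h : form x y = r) : form y x = r := by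
  rw [← conj_form, h, Complex.conj_ofReal]

theorem form_swap_zero {x y : E} (h : form x y = 0) : form y x = 0 := by
  rw [← conj_form, h, map_zero]

theorem PreservesTruncation.isFramePair (hΔ : PreservesTruncation Δ)
    (hb : Function.Bijective Δ) {r : ℝ} (hr : coeffMap Δ (realAtom E 0) (1 / 2) = r) :
    IsFramePair r (Δ (realAtom E 0)) (Δ (realAtom E (Real.pi / 2)))
      (Δ (realAtom E (Real.pi / 4))) (Δ (realAtom E (-(Real.pi / 4)))) := by
  have hs : Real.sin (Real.pi / 4) ^ 2 = 1 / 2 := by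
    rw [Real.sin_pi_div_four, ← Real.cos_pi_div_four, cos_pi_div_four_sq]
  have hr' : coeffMap Δ (realAtom E 0) (2⁻¹) = r := by rw [← hr, one_div]
  have h4 := abs_pi_div_four_lt_pi
  have h4' := abs_neg_pi_div_four_lt_pi
  constructor
  · exact (hΔ.isAtom hb (isAtom_realAtom _)).form_self
  · exact (hΔ.isAtom hb (isAtom_realAtom _)).form_self
  · rw [hΔ.form_map_realAtom hb abs_pi_div_two_lt_pi, form_realAtom_realAtom]
    simp [hΔ.coeffMap_zero hb]
  · exact (hΔ.isAtom hb (isAtom_realAtom _)).form_self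
  · exact (hΔ.isAtom hb (isAtom_realAtom _)).form_self
  · rw [hΔ.form_map_realAtom hb h4', form_realAtom_realAtom,
      show Real.pi / 4 - -(Real.pi / 4) = Real.pi / 2 by ring]
    simp [hΔ.coeffMap_zero hb]
  · rw [hΔ.form_map_realAtom hb h4, form_realAtom_realAtom, zero_sub, Real.cos_neg,
      cos_pi_div_four_sq]
    simpa using hr'
  · rw [hΔ.form_map_realAtom hb h4', form_realAtom_realAtom, zero_sub, neg_neg,
      cos_pi_div_four_sq]
    simpa using hr'
  · rw [hΔ.form_map_realAtom hb h4, form_realAtom_realAtom, Real.cos_pi_div_two_sub, hs]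
    simpa using hr'
  · rw [hΔ.form_map_realAtom hb h4', form_realAtom_realAtom, Real.cos_pi_div_two_sub,
      Real.sin_neg, neg_sq, hs]
    simpa using hr'

/-- The square of the norm of `v₁ + v₂ - w₁ - w₂` is `4 - 8 * r`, which vanishes for
`r = 1 / 2`. -/
theorem IsFramePair.add_eq_add {v₁ v₂ w₁ w₂ : E} (h : IsFramePair (1 / 2) v₁ v₂ w₁ w₂) :
    v₁ + v₂ = w₁ + w₂ := by
  rw [← sub_eq_zero, ← form_self_eq_zero]
  simp only [form_sub_left, form_sub_right, form_add_left, form_add_right, h.v₁₁, h.v₂₂, h.v₁₂,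
    h.w₁₁, h.w₂₂, h.w₁₂, h.v₁w₁, h.v₁w₂, h.v₂w₁, h.v₂w₂, form_swap h.v₁w₁, form_swap h.v₁w₂,
    form_swap h.v₂w₁, form_swap h.v₂w₂, form_swap_zero h.v₁₂, form_swap_zero h.w₁₂]
  push_cast
  ring

/-- Additivity comes from pairing `Δ c` with the two sides of `IsFramePair.add_eq_add`. -/
theorem PreservesTruncation.coeffMap_add (hΔ : PreservesTruncation Δ)
    (hb : Function.Bijective Δ) (hhalf : coeffMap Δ (realAtom E 0) (1 / 2) = 1 / 2) (a b : ℂ) :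
    coeffMap Δ (realAtom E 0) (a + b)
      = coeffMap Δ (realAtom E 0) a + coeffMap Δ (realAtom E 0) b := by
  -- The symmetric element whose inner products with the projections at the angles
  -- `0`, `π / 2`, `π / 4`, `-π / 4` are `a + b`, `0`, `a`, `b`.
  obtain ⟨c, hc⟩ := exists_toMat_eq (E := E) !![a + b, (a - b) / 2; (a - b) / 2, 0]
    (by ext i j; fin_cases i <;> fin_cases j <;> rfl)
  have hsum := congrArg (form (Δ c))
    (hΔ.isFramePair hb (r := 1 / 2) (by rw [hhalf]; norm_num)).add_eq_add
  have hc2 : (Real.cos (Real.pi / 4) : ℂ) ^ 2 = 1 / 2 := by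
    rw [← Complex.ofReal_pow, cos_pi_div_four_sq]; norm_num
  have hsc : Real.sin (Real.pi / 4) = Real.cos (Real.pi / 4) := by simp
  rw [form_add_right, form_add_right, hΔ.form_map_realAtom hb abs_zero_lt_pi,
    hΔ.form_map_realAtom hb abs_pi_div_two_lt_pi, hΔ.form_map_realAtom hb abs_pi_div_four_lt_pi,
    hΔ.form_map_realAtom hb abs_neg_pi_div_four_lt_pi] at hsum
  have h1 : form c (realAtom E 0) = a + b := by rw [form_realAtom, hc]; simp
  have h2 : form c (realAtom E (Real.pi / 2)) = 0 := by rw [form_realAtom, hc]; simp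
  have h3 : form c (realAtom E (Real.pi / 4)) = a := by
    rw [form_realAtom, hc, hsc]
    simp only [Matrix.of_apply, Matrix.cons_val', Matrix.cons_val_zero, Matrix.cons_val_one,
      Matrix.cons_val_fin_one]
    linear_combination (2 * a) * hc2
  have h4 : form c (realAtom E (-(Real.pi / 4))) = b := by
    rw [form_realAtom, hc, Real.cos_neg, Real.sin_neg, hsc, Complex.ofReal_neg]
    simp only [Matrix.of_apply, Matrix.cons_val', Matrix.cons_val_zero, Matrix.cons_val_one,
      Matrix.cons_val_fin_one]
    linear_combination (2 * b) * hc2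
  rwa [h1, h2, h3, h4, hΔ.coeffMap_zero hb, add_zero] at hsum

theorem PreservesTruncation.coeffMap_eq_id_or_eq_conj (hΔ : PreservesTruncation Δ)
    (hb : Function.Bijective Δ) (hhalf : coeffMap Δ (realAtom E 0) (1 / 2) = 1 / 2) :
    (∀ a, coeffMap Δ (realAtom E 0) a = a) ∨ ∀ a, coeffMap Δ (realAtom E 0) a = conj a :=
  eq_id_or_eq_conj (hΔ.coeffMap_add hb hhalf) (hΔ.coeffMap_one hb (isAtom_realAtom 0))
    (hΔ.coeffMap_conj hb (isAtom_realAtom 0)) (fun _ h => hΔ.coeffMap_inv hb (isAtom_realAtom 0) h)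
    fun _ h0 h1 => hΔ.coeffMap_ofReal_mul hb h0 h1

/-! ### Linearity -/

/-- The images of the minimal tripotents with the common coefficient function separate points. -/
def SeparatesPoints (Δ : E → E) : Prop :=
  ∀ x, (∀ e, IsAtom e → coeffMap Δ e = coeffMap Δ (realAtom E 0) → form x (Δ e) = 0) → x = 0

theorem SeparatesPoints.ext (h : SeparatesPoints Δ) {x y : E}
    (hxy : ∀ e, IsAtom e → coeffMap Δ e = coeffMap Δ (realAtom E 0) →
      form x (Δ e) = form y (Δ e)) : x = y :=
  sub_eq_zero.1 (h _ fun e he hf => by rw [form_sub_left, hxy e he hf, sub_self])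

theorem SeparatesPoints.map_add (h : SeparatesPoints Δ) (hΔ : PreservesTruncation Δ)
    (hb : Function.Bijective Δ)
    (hf : ∀ a b, coeffMap Δ (realAtom E 0) (a + b)
      = coeffMap Δ (realAtom E 0) a + coeffMap Δ (realAtom E 0) b) (x y : E) :
    Δ (x + y) = Δ x + Δ y :=
  h.ext fun e he hfe => by
    rw [form_add_left, hΔ.form_map_map hb he, hΔ.form_map_map hb he, hΔ.form_map_map hb he, hfe,
      form_add_left, hf]

theorem SeparatesPoints.map_smul (h : SeparatesPoints Δ) (hΔ : PreservesTruncation Δ)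
    (hb : Function.Bijective Δ) {σ : ℂ →+* ℂ} (hf : ∀ a, coeffMap Δ (realAtom E 0) a = σ a)
    (c : ℂ) (x : E) : Δ (c • x) = σ c • Δ x :=
  h.ext fun e he hfe => by
    rw [form_smul_left, hΔ.form_map_map hb he, hΔ.form_map_map hb he, hfe,
      form_smul_left, hf, hf, map_mul]

/-- For a minimal tripotent `e` and `a ≠ 0`, that `a • e` is a truncation of `Q b c` means
`form (Q b c) e = a`; so the hypothesis on `Δ` determines all `form (Q (Δ b) (Δ c)) (Δ e)`. -/
theorem SeparatesPoints.map_Q (h : SeparatesPoints Δ) (hΔ : PreservesTruncation Δ)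
    (hb : Function.Bijective Δ) (hf : Function.Surjective (coeffMap Δ (realAtom E 0))) (b c : E) :
    Δ (Q b c) = Q (Δ b) (Δ c) := by
  refine h.ext fun e he hfe => ?_
  have key : ∀ a, a ≠ 0 → (form (Q b c) e = a ↔
      form (Q (Δ b) (Δ c)) (Δ e) = coeffMap Δ e a) := by
    intro a ha
    rw [← he.isTruncation_smul_iff ha, hΔ, hΔ.map_smul hb he,
      (hΔ.isAtom hb he).isTruncation_smul_iff (hΔ.coeffMap_ne_zero hb he ha)]
  rw [hΔ.form_map_map hb he]
  by_cases h0 : form (Q b c) e = 0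
  · -- A nonzero value on the right would come from a nonzero value on the left.
    obtain ⟨a, ha⟩ := hf (form (Q (Δ b) (Δ c)) (Δ e))
    rw [← hfe] at ha
    by_cases ha0 : a = 0
    · rw [h0, ← ha, ha0]
    · rw [(key a ha0).2 ha.symm] at h0
      exact absurd h0 ha0
  · exact ((key _ h0).1 rfl).symm

theorem SeparatesPoints.isTripleAut (h : SeparatesPoints Δ) (hΔ : PreservesTruncation Δ)
    (hb : Function.Bijective Δ) (hhalf : coeffMap Δ (realAtom E 0) (1 / 2) = 1 / 2) :
    ((∀ e : E, IsMinimalTripotent e → ∀ c : ℂ, Δ (c • e) = c • Δ e) ∨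
      (∀ e : E, IsMinimalTripotent e → ∀ c : ℂ, Δ (c • e) = (starRingEnd ℂ c) • Δ e)) ∧
    (IsLinearTripleAut Δ ∨ IsConjLinearTripleAut Δ) := by
  have hadd := h.map_add hΔ hb (hΔ.coeffMap_add hb hhalf)
  rcases hΔ.coeffMap_eq_id_or_eq_conj hb hhalf with hf | hf
  · have hsmul := h.map_smul hΔ hb (σ := RingHom.id ℂ) hf
    refine ⟨Or.inl fun e _ c => hsmul c e, Or.inl ?_⟩
    let T : E →ₗ[ℂ] E := { toFun := Δ, map_add' := hadd, map_smul' := hsmul }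
    exact ⟨LinearEquiv.ofBijective T hb, fun _ => rfl,
      map_tp_of_map_Q hadd (h.map_Q hΔ hb fun a => ⟨a, hf a⟩)⟩
  · have hsmul := h.map_smul hΔ hb (σ := starRingEnd ℂ) hf
    refine ⟨Or.inr fun e _ c => hsmul c e, Or.inr ?_⟩
    let T : E →ₛₗ[starRingEnd ℂ] E := { toFun := Δ, map_add' := hadd, map_smul' := hsmul }
    exact ⟨LinearEquiv.ofBijective T hb, fun _ => rfl,
      map_tp_of_map_Q hadd (h.map_Q hΔ hb fun a =>
        ⟨conj a, by rw [hf, Complex.conj_conj]⟩)⟩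

end preservers

/-! ### Symmetric matrices -/

instance : Module.Finite ℂ S₂ :=
  inferInstanceAs (Module.Finite ℂ symmetricMatrices)

theorem finrank_S₂_le : Module.finrank ℂ S₂ ≤ 3 := by
  let L : S₂ →ₗ[ℂ] (Fin 3 → ℂ) :=
    { toFun := fun A => ![(A : M₂) 0 0, (A : M₂) 0 1, (A : M₂) 1 1]
      map_add' := fun A B => by simp
      map_smul' := fun c A => by simp }
  have hL : Function.Injective L := by
    intro A B h
    have h0 : (A : M₂) 0 0 = (B : M₂) 0 0 := congrFun h 0
    have h1 : (A : M₂) 0 1 = (B : M₂) 0 1 := congrFun h 1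
    have h2 : (A : M₂) 1 1 = (B : M₂) 1 1 := congrFun h 2
    have hA : (A : M₂) 0 1 = (A : M₂) 1 0 := congrFun (congrFun A.2 1) 0
    have hB : (B : M₂) 0 1 = (B : M₂) 1 0 := congrFun (congrFun B.2 1) 0
    apply Subtype.ext
    ext i j
    fin_cases i <;> fin_cases j
    exacts [h0, h1, hA.symm.trans (h1.trans hB), h2]
  simpa using LinearMap.finrank_le_finrank_of_injective hL

/-- In dimension three the orthogonal vectors `v₁ + v₂`, `v₁ - v₂`, `w₁ - w₂` separate points. -/
theorem IsFramePair.eq_zero {v₁ v₂ w₁ w₂ : S₂} {r : ℝ} (h : IsFramePair r v₁ v₂ w₁ w₂) {x : S₂}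
    (h1 : form x (v₁ + v₂) = 0) (h2 : form x (v₁ - v₂) = 0) (h3 : form x (w₁ - w₂) = 0) :
    x = 0 := by
  have ha : form (v₁ + v₂) (v₁ - v₂) = 0 := by
    simp only [form_add_left, form_sub_right, h.v₁₁, h.v₂₂, h.v₁₂, form_swap_zero h.v₁₂]; ring
  have hb : form (v₁ + v₂) (w₁ - w₂) = 0 := by
    simp only [form_add_left, form_sub_right, h.v₁w₁, h.v₁w₂, h.v₂w₁, h.v₂w₂]; ring
  have hc : form (v₁ - v₂) (w₁ - w₂) = 0 := by
    simp only [form_sub_left, form_sub_right, h.v₁w₁, h.v₁w₂, h.v₂w₁, h.v₂w₂]; ring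
  have na : v₁ + v₂ ≠ 0 := by
    rw [Ne, ← form_self_eq_zero]
    simp only [form_add_left, form_add_right, h.v₁₁, h.v₂₂, h.v₁₂, form_swap_zero h.v₁₂]
    norm_num
  have nb : v₁ - v₂ ≠ 0 := by
    rw [Ne, ← form_self_eq_zero]
    simp only [form_sub_left, form_sub_right, h.v₁₁, h.v₂₂, h.v₁₂, form_swap_zero h.v₁₂]
    norm_num
  have nc : w₁ - w₂ ≠ 0 := by
    rw [Ne, ← form_self_eq_zero]
    simp only [form_sub_left, form_sub_right, h.w₁₁, h.w₂₂, h.w₁₂, form_swap_zero h.w₁₂]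
    norm_num
  refine eq_zero_of_form_eq_zero finrank_S₂_le inferInstance ![v₁ + v₂, v₁ - v₂, w₁ - w₂]
    ?_ ?_ x ?_
  · intro i; fin_cases i
    exacts [na, nb, nc]
  · intro i j hij
    fin_cases i <;> fin_cases j
    exacts [absurd rfl hij, ha, hb, form_swap_zero ha, absurd rfl hij, hc, form_swap_zero hb,
      form_swap_zero hc, absurd rfl hij]
  · intro i; fin_cases i
    exacts [h1, h2, h3]

/-- In dimension three the sums of two frames are parallel, and comparing norms gives `r`. -/
theorem IsFramePair.eq_half {v₁ v₂ w₁ w₂ : S₂} {r : ℝ} (h : IsFramePair r v₁ v₂ w₁ w₂)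
    (hr : 0 < r) : r = 1 / 2 := by
  have hx : w₁ + w₂ - (2 * r : ℂ) • (v₁ + v₂) = 0 := by
    apply h.eq_zero <;>
      simp only [form_sub_left, form_sub_right, form_add_left, form_add_right, form_smul_left,
        h.v₁₁, h.v₂₂, h.v₁₂, h.w₁₁, h.w₂₂, h.w₁₂, h.v₁w₁, h.v₁w₂, h.v₂w₁, h.v₂w₂,
        form_swap h.v₁w₁, form_swap h.v₁w₂, form_swap h.v₂w₁, form_swap h.v₂w₂,
        form_swap_zero h.v₁₂, form_swap_zero h.w₁₂] <;> ring
  have h1 : form (w₁ + w₂ - (2 * r : ℂ) • (v₁ + v₂)) (w₁ + w₂) = 0 := by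
    rw [hx, form_zero_left]
  simp only [form_sub_left, form_add_left, form_add_right, form_smul_left,
    h.w₁₁, h.w₂₂, h.w₁₂, h.v₁w₁, h.v₁w₂, h.v₂w₁, h.v₂w₂, form_swap_zero h.w₁₂] at h1
  have h2 : (1 - 2 * r) * (1 + 2 * r) = 0 := by
    apply Complex.ofReal_injective
    push_cast
    linear_combination h1 / 2
  rcases mul_eq_zero.1 h2 with h3 | h3 <;> linarith

theorem PreservesTruncation.isTripleAut_S₂ {Δ : S₂ → S₂} (hΔ : PreservesTruncation Δ)
    (hb : Function.Bijective Δ) :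
    ((∀ e : S₂, IsMinimalTripotent e → ∀ c : ℂ, Δ (c • e) = c • Δ e) ∨
      (∀ e : S₂, IsMinimalTripotent e → ∀ c : ℂ, Δ (c • e) = (starRingEnd ℂ c) • Δ e)) ∧
    (IsLinearTripleAut Δ ∨ IsConjLinearTripleAut Δ) := by
  obtain ⟨r, hr, hr'⟩ := hΔ.coeffMap_half_pos hb
  have hF := hΔ.isFramePair hb hr'
  refine SeparatesPoints.isTripleAut (fun x hx => ?_) hΔ hb (by
    rw [hr', hF.eq_half hr]; norm_num)
  have hx' : ∀ φ : ℝ, |φ| < Real.pi → form x (Δ (realAtom S₂ φ)) = 0 := fun φ hφ =>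
    hx _ (isAtom_realAtom φ) (hΔ.coeffMap_realAtom hb hφ)
  have h1 := hx' 0 abs_zero_lt_pi
  have h2 := hx' _ abs_pi_div_two_lt_pi
  apply hF.eq_zero
  · rw [form_add_right, h1, h2, add_zero]
  · rw [form_sub_right, h1, h2, sub_zero]
  · rw [form_sub_right, hx' _ abs_pi_div_four_lt_pi, hx' _ abs_neg_pi_div_four_lt_pi, sub_zero]

/-! ### All matrices -/

theorem isAtom_single (i j : Fin 2) : IsAtom (Matrix.single i j 1 : M₂) where
  isSingular := by
    change Matrix.det (Matrix.single i j 1 : M₂) = 0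
    fin_cases i <;> fin_cases j <;> simp [Matrix.det_fin_two]
  form_self := by
    rw [form_eq]
    change (Matrix.single i j 1 : M₂) 0 0 * conj ((Matrix.single i j 1 : M₂) 0 0)
      + (Matrix.single i j 1 : M₂) 0 1 * conj ((Matrix.single i j 1 : M₂) 0 1)
      + (Matrix.single i j 1 : M₂) 1 0 * conj ((Matrix.single i j 1 : M₂) 1 0)
      + (Matrix.single i j 1 : M₂) 1 1 * conj ((Matrix.single i j 1 : M₂) 1 1) = 1
    fin_cases i <;> fin_cases j <;> simp

theorem form_single (x : M₂) (i j : Fin 2) : form x (Matrix.single i j 1) = x i j := by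
  rw [form_eq]
  change x 0 0 * conj ((Matrix.single i j 1 : M₂) 0 0)
      + x 0 1 * conj ((Matrix.single i j 1 : M₂) 0 1)
      + x 1 0 * conj ((Matrix.single i j 1 : M₂) 1 0)
      + x 1 1 * conj ((Matrix.single i j 1 : M₂) 1 1) = x i j
  fin_cases i <;> fin_cases j <;> simp

theorem realAtom_pi_div_four_apply (i j : Fin 2) :
    realAtom M₂ (Real.pi / 4) i j = 1 / 2 := by
  have hc2 : (Real.cos (Real.pi / 4) : ℂ) ^ 2 = 1 / 2 := by
    rw [← Complex.ofReal_pow, cos_pi_div_four_sq]; norm_num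
  have hsc : Real.sin (Real.pi / 4) = Real.cos (Real.pi / 4) := by simp
  have h : realAtom M₂ (Real.pi / 4) = _ := toMat_realAtom (E := M₂) (Real.pi / 4)
  rw [h, hsc, ← pow_two, hc2]
  fin_cases i <;> fin_cases j <;> rfl

section

variable {Δ : M₂ → M₂}

/-- The rank-one matrix with all entries `1 / 2` has the same inner product with all matrix units
and with the projection at the angle `π / 2`. -/
theorem PreservesTruncation.coeffMap_single (hΔ : PreservesTruncation Δ)
    (hb : Function.Bijective Δ) (i j : Fin 2) :
    coeffMap Δ (Matrix.single i j 1 : M₂) = coeffMap Δ (realAtom M₂ 0) := by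
  rw [← hΔ.coeffMap_realAtom hb abs_pi_div_two_lt_pi]
  have h1 : form (Matrix.single i j 1 : M₂) (realAtom M₂ (Real.pi / 4)) = 1 / 2 := by
    rw [← conj_form, form_single, realAtom_pi_div_four_apply]; simp [map_ofNat]
  have h2 : form (realAtom M₂ (Real.pi / 2)) (realAtom M₂ (Real.pi / 4)) = 1 / 2 := by
    rw [form_realAtom_realAtom, show Real.pi / 2 - Real.pi / 4 = Real.pi / 4 by ring,
      cos_pi_div_four_sq]
    norm_num
  exact hΔ.coeffMap_eq hb (isAtom_single i j) (isAtom_realAtom _)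
    (isAtom_realAtom (Real.pi / 4)) (h1.trans h2.symm) (by rw [h2]; norm_num)

theorem PreservesTruncation.form_map_single (hΔ : PreservesTruncation Δ)
    (hb : Function.Bijective Δ) (x : M₂) (i j : Fin 2) :
    form (Δ x) (Δ (Matrix.single i j 1)) = coeffMap Δ (realAtom M₂ 0) (x i j) := by
  rw [hΔ.form_map_map hb (isAtom_single i j), hΔ.coeffMap_single hb, form_single]

theorem PreservesTruncation.form_map_single_single (hΔ : PreservesTruncation Δ)
    (hb : Function.Bijective Δ) (i j k l : Fin 2) :
    form (Δ (Matrix.single k l 1)) (Δ (Matrix.single i j 1))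
      = if k = i ∧ l = j then 1 else 0 := by
  rw [hΔ.form_map_single hb, Matrix.single_apply]
  split_ifs
  · exact hΔ.coeffMap_one hb (isAtom_realAtom 0)
  · exact hΔ.coeffMap_zero hb _

/-- The images of the four matrix units form an orthogonal basis. -/
theorem PreservesTruncation.eq_zero_of_form_single (hΔ : PreservesTruncation Δ)
    (hb : Function.Bijective Δ) {x : M₂}
    (hx : ∀ i j, form x (Δ (Matrix.single i j 1)) = 0) : x = 0 := by
  let q : Fin 4 ≃ Fin 2 × Fin 2 := (finProdFinEquiv (m := 2) (n := 2)).symm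
  refine eq_zero_of_form_eq_zero (n := 4) (by simp [Module.finrank_matrix]) inferInstance
    (fun k => Δ (Matrix.single (q k).1 (q k).2 1)) ?_ ?_ x fun k => hx _ _
  · exact fun k => (hΔ.isAtom hb (isAtom_single _ _)).ne_zero
  · intro k l hkl
    rw [hΔ.form_map_single_single hb, if_neg]
    exact fun h => hkl (q.injective (Prod.ext h.1 h.2))

/-- Parseval's identity for the rank-one matrix with all entries `1 / 2`. -/
theorem PreservesTruncation.coeffMap_half (hΔ : PreservesTruncation Δ)
    (hb : Function.Bijective Δ) : coeffMap Δ (realAtom M₂ 0) (1 / 2) = 1 / 2 := by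
  obtain ⟨r, hr, hr'⟩ := hΔ.coeffMap_half_pos hb
  set w := Δ (realAtom M₂ (Real.pi / 4)) with hw
  have hwv : ∀ i j, form w (Δ (Matrix.single i j 1)) = r := fun i j => by
    rw [hw, hΔ.form_map_single hb, realAtom_pi_div_four_apply, hr']
  have hexp : w - (r : ℂ) • (Δ (Matrix.single 0 0 1) + Δ (Matrix.single 0 1 1)
      + Δ (Matrix.single 1 0 1) + Δ (Matrix.single 1 1 1)) = 0 := by
    refine hΔ.eq_zero_of_form_single hb fun i j => ?_
    simp only [form_sub_left, form_smul_left, form_add_left, hwv, hΔ.form_map_single_single hb]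
    fin_cases i <;> fin_cases j <;> simp
  have h1 : form (w - (r : ℂ) • (Δ (Matrix.single 0 0 1) + Δ (Matrix.single 0 1 1)
      + Δ (Matrix.single 1 0 1) + Δ (Matrix.single 1 1 1))) w = 0 := by
    rw [hexp, form_zero_left]
  simp only [form_sub_left, form_smul_left, form_add_left, form_swap (hwv _ _)] at h1
  rw [hw, (hΔ.isAtom hb (isAtom_realAtom _)).form_self] at h1
  have h2 : (1 - 2 * r) * (1 + 2 * r) = 0 := by
    apply Complex.ofReal_injective
    push_cast
    linear_combination h1
  have h3 : r = 1 / 2 := by rcases mul_eq_zero.1 h2 with h3 | h3 <;> linarith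
  rw [hr', h3]; norm_num

theorem PreservesTruncation.isTripleAut_M₂ (hΔ : PreservesTruncation Δ)
    (hb : Function.Bijective Δ) :
    ((∀ e : M₂, IsMinimalTripotent e → ∀ c : ℂ, Δ (c • e) = c • Δ e) ∨
      (∀ e : M₂, IsMinimalTripotent e → ∀ c : ℂ, Δ (c • e) = (starRingEnd ℂ c) • Δ e)) ∧
    (IsLinearTripleAut Δ ∨ IsConjLinearTripleAut Δ) :=
  SeparatesPoints.isTripleAut (fun _ hx => hΔ.eq_zero_of_form_single hb fun i j =>
    hx _ (isAtom_single i j) (hΔ.coeffMap_single hb i j)) hΔ hb (hΔ.coeffMap_half hb)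

end

end JordanTriple

theorem mainTheorem3 :
    (∀ Δ : JordanTriple.S₂ → JordanTriple.S₂,
      Function.Bijective Δ → JordanTriple.PreservesTruncation Δ →
        ((∀ e : JordanTriple.S₂, JordanTriple.IsMinimalTripotent e →
            ∀ c : ℂ, Δ (c • e) = c • Δ e) ∨
          (∀ e : JordanTriple.S₂, JordanTriple.IsMinimalTripotent e →
            ∀ c : ℂ, Δ (c • e) = (starRingEnd ℂ c) • Δ e)) ∧
        (JordanTriple.IsLinearTripleAut Δ ∨ JordanTriple.IsConjLinearTripleAut Δ)) ∧
    (∀ Δ : JordanTriple.M₂ → JordanTriple.M₂,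
      Function.Bijective Δ → JordanTriple.PreservesTruncation Δ →
        ((∀ e : JordanTriple.M₂, JordanTriple.IsMinimalTripotent e →
            ∀ c : ℂ, Δ (c • e) = c • Δ e) ∨
          (∀ e : JordanTriple.M₂, JordanTriple.IsMinimalTripotent e →
            ∀ c : ℂ, Δ (c • e) = (starRingEnd ℂ c) • Δ e)) ∧
        (JordanTriple.IsLinearTripleAut Δ ∨ JordanTriple.IsConjLinearTripleAut Δ)) :=
  ⟨fun _ hb hΔ => hΔ.isTripleAut_S₂ hb, fun _ hb hΔ => hΔ.isTripleAut_M₂ hb⟩
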